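/- Proposition 3.2. Let $A$ be a closed symmetric operator (not necessarily densely defined) in a complex Hilbert space $H$. Let $\widehat A$ be a self-adjoint operator in a Hilbert space $\widehat H \supseteq H$ that extends $A$, and let $\widehat E(\delta)$, $\delta\in\mathfrak B(\mathbb R)$, be the orthogonal spectral measure of $\widehat A$, so that $\widehat A=\int_{\mathbb R} t\,d\widehat E(t)$. Let $$\mathbf E(\delta)=P^{\widehat H}_{H}\,\widehat E(\delta)\big|_{H}\quad(\delta\in\mathfrak B(\mathbb R)),\qquad \mathbf R_z(A)=P^{\widehat H}_{H}\,(\widehat A-z)^{-1}\big|_{H}\quad(z\in\mathbb R_e:=\mathbb C\setminus\mathbb R)$$ be the spectral measure of $A$ and the corresponding generalized resolvent of $A$ defined by $\widehat A$, where $P^{\widehat H}_{H}$ is the orthogonal projection of $\widehat H$ onto $H$. Let $\Delta\subseteq\mathbb R$ be an open set. Then the following two conditions are equivalent: (i) $\mathbf E(\Delta)=0$; (ii) $\mathbf R_z(A)$ admits an analytic continuation to $\mathbb R_e\cup\Delta$, i.e. there is a function, analytic in the operator norm at every point of $\mathbb R_e\cup\Delta$, with values in the bounded operators on $H$, that coincides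 with $\mathbf R_z(A)$ for all $z\in\mathbb R_e$. -/

import Mathlib

open MeasureTheory
open scoped InnerProductSpace ENNReal

/-- An orthogonal spectral measure (projection-valued measure) on the Borel subsets of `ℝ` with
values in the bounded operators of a Hilbert space `K`; the values on sets that are not
Borel carry no information. -/
structure OrthogonalSpectralMeasure (K : Type*) [NormedAddCommGroup K] [InnerProductSpace ℂ K]
    [CompleteSpace K] where
  /-- The operator attached to a set. -/
  proj : Set ℝ → K →L[ℂ] K
  /-- Values on Borel sets are orthogonal projections. -/
  isStarProjection : ∀ s, MeasurableSet s → IsStarProjection (proj s)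
  proj_univ : proj Set.univ = 1
  proj_inter : ∀ s t, MeasurableSet s → MeasurableSet t → proj (s ∩ t) = proj s * proj t
  /-- Countable additivity in the strong operator topology. -/
  hasSum_proj : ∀ f : ℕ → Set ℝ, (∀ i, MeasurableSet (f i)) →
    Pairwise (Function.onFun Disjoint f) →
    ∀ x : K, HasSum (fun i => proj (f i) x) (proj (⋃ i, f i) x)

namespace OrthogonalSpectralMeasure

variable {K : Type*} [NormedAddCommGroup K] [InnerProductSpace ℂ K] [CompleteSpace K]

theorem proj_empty (P : OrthogonalSpectralMeasure K) : P.proj ∅ = 0 := by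
  ext x
  have h := P.hasSum_proj (fun _ => ∅) (fun _ => MeasurableSet.empty)
    (fun i j _ => by simp [Function.onFun]) x
  simpa using tendsto_nhds_unique h.summable.tendsto_atTop_zero tendsto_const_nhds |>.symm

theorem inner_proj_self (P : OrthogonalSpectralMeasure K) {s : Set ℝ} (hs : MeasurableSet s)
    (x : K) : (⟪x, P.proj s x⟫_ℂ).re = ‖P.proj s x‖ ^ 2 := by
  have h := P.isStarProjection s hs
  have h1 : P.proj s (P.proj s x) = P.proj s x := by
    have := h.isIdempotentElem
    exact congrArg (fun T : K →L[ℂ] K => T x) this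
  have h2 : ⟪P.proj s x, P.proj s x⟫_ℂ = ⟪x, P.proj s x⟫_ℂ := by
    have h3 : ContinuousLinearMap.adjoint (P.proj s) = P.proj s := h.isSelfAdjoint
    have h4 := ContinuousLinearMap.adjoint_inner_left (P.proj s) (P.proj s x) x
    rwa [h3, h1] at h4
  rw [← h2, inner_self_eq_norm_sq_to_K]
  norm_cast

/-- The scalar measure `s ↦ ⟪x, P(s) x⟫` on the Borel sets of `ℝ`. -/
noncomputable def scalarMeasure (P : OrthogonalSpectralMeasure K) (x : K) : Measure ℝ :=
  Measure.ofMeasurable (fun s _ => ENNReal.ofReal (⟪x, P.proj s x⟫_ℂ).re)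
    (by simp [P.proj_empty])
    (by
      intro f hf hd
      have h1 : HasSum (fun i => (⟪x, P.proj (f i) x⟫_ℂ).re)
          (⟪x, P.proj (⋃ i, f i) x⟫_ℂ).re :=
        Complex.hasSum_re (((innerSL ℂ x).hasSum (P.hasSum_proj f hf hd x)))
      rw [← h1.tsum_eq]
      refine ENNReal.ofReal_tsum_of_nonneg (fun i => ?_) h1.summable
      rw [P.inner_proj_self (hf i)]
      positivity)

/-- `P` is the spectral measure of the operator `T`, i.e. `T = ∫ t dP(t)`: the domain of `T`
consists of the `x` with `∫ t² d⟪x, P(t) x⟫ < ∞`, and `⟪x, T x⟫ = ∫ t d⟪x, P(t) x⟫` for these `x`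
(by polarization this determines `T`). -/
def IsSpectralMeasureOf (P : OrthogonalSpectralMeasure K) (T : K →ₗ.[ℂ] K) : Prop :=
  (∀ x : K, x ∈ T.domain ↔ Integrable (fun t : ℝ => t ^ 2) (P.scalarMeasure x)) ∧
    ∀ x : T.domain, ⟪(x : K), T x⟫_ℂ = ((∫ t : ℝ, t ∂(P.scalarMeasure (x : K)) : ℝ) : ℂ)

end OrthogonalSpectralMeasure

/-- `R` is the resolvent `(T - z)⁻¹` of `T` at the point `z`: a bounded operator on the whole
space, with values in the domain of `T`, which is a two-sided inverse of `T - z`. -/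
def IsResolventAt {K : Type*} [NormedAddCommGroup K] [InnerProductSpace ℂ K]
    (T : K →ₗ.[ℂ] K) (z : ℂ) (R : K →L[ℂ] K) : Prop :=
  (∀ y : K, ∃ h : R y ∈ T.domain, T ⟨R y, h⟩ - z • R y = y) ∧
    ∀ x : T.domain, R (T x - z • (x : K)) = x

theorem IsResolventAt.unique {K : Type*} [NormedAddCommGroup K] [InnerProductSpace ℂ K]
    {T : K →ₗ.[ℂ] K} {z : ℂ} {R S : K →L[ℂ] K} (hR : IsResolventAt T z R)
    (hS : IsResolventAt T z S) : R = S := by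
  ext y
  obtain ⟨h, hy⟩ := hS.1 y
  have h1 := hR.2 ⟨S y, h⟩
  rw [hy] at h1
  exact h1

open Classical in
/-- The resolvent `(T - z)⁻¹`, when `z` is a regular point of `T` (and `0` otherwise; all
non-real `z` are regular points of a self-adjoint `T`). -/
noncomputable def operatorResolvent {K : Type*} [NormedAddCommGroup K] [InnerProductSpace ℂ K]
    (T : K →ₗ.[ℂ] K) (z : ℂ) : K →L[ℂ] K :=
  if h : ∃ R : K →L[ℂ] K, IsResolventAt T z R then h.choose else 0

/-- A self-adjoint extension of the operator `A` in `H`, acting in a Hilbert space `K ⊇ H`. The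
inclusion of `H` in `K` is the isometric embedding `incl`. -/
structure SelfAdjointExtension {H : Type*} [NormedAddCommGroup H] [InnerProductSpace ℂ H]
    (A : H →ₗ.[ℂ] H) (K : Type*) [NormedAddCommGroup K] [InnerProductSpace ℂ K]
    [CompleteSpace K] where
  incl : H →ₗᵢ[ℂ] K
  op : K →ₗ.[ℂ] K
  isSelfAdjoint_op : IsSelfAdjoint op
  extends_op : ∀ x : A.domain, ∃ h : incl x ∈ op.domain, op ⟨incl x, h⟩ = incl (A x)

namespace SelfAdjointExtension

variable {H : Type*} [NormedAddCommGroup H] [InnerProductSpace ℂ H] [CompleteSpace H]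
  {A : H →ₗ.[ℂ] H}
  {K : Type*} [NormedAddCommGroup K] [InnerProductSpace ℂ K] [CompleteSpace K]

/-- The compression to `H` of a bounded operator `S` on `K ⊇ H`: the operator `f ↦ P_H (S f)` on
`H`. The adjoint of the embedding of `H` is the orthogonal projection of `K` on `H`. -/
noncomputable def compression (X : SelfAdjointExtension A K) (S : K →L[ℂ] K) : H →L[ℂ] H :=
  (ContinuousLinearMap.adjoint X.incl.toContinuousLinearMap) ∘L S ∘L
    X.incl.toContinuousLinearMap

/-- The generalized resolvent of `A` defined by the self-adjoint extension `X`. -/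
noncomputable def generalizedResolvent (X : SelfAdjointExtension A K) (z : ℂ) : H →L[ℂ] H :=
  X.compression (operatorResolvent X.op z)

/-- The spectral measure of `A` defined by the self-adjoint extension `X` whose orthogonal
spectral measure is `P`. -/
noncomputable def spectralMeasure (X : SelfAdjointExtension A K)
    (P : OrthogonalSpectralMeasure K) (δ : Set ℝ) : H →L[ℂ] H :=
  X.compression (P.proj δ)

end SelfAdjointExtension

/-- `R`, given at the non-real points, admits an analytic continuation (in the operator norm) to
`(ℂ \ ℝ) ∪ Δ`. -/
def AdmitsAnalyticContinuation {H : Type*} [NormedAddCommGroup H] [InnerProductSpace ℂ H]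
    (R : ℂ → H →L[ℂ] H) (Δ : Set ℝ) : Prop :=
  ∃ F : ℂ → H →L[ℂ] H,
    AnalyticOnNhd ℂ F ({z : ℂ | z.im ≠ 0} ∪ (fun t : ℝ => (t : ℂ)) '' Δ) ∧
      ∀ z : ℂ, z.im ≠ 0 → F z = R z

/-! Compression turns both conditions into statements about vectors `k` of the embedded `H`. Since
`⟪k, P(Δ) k⟫ = ‖P(Δ) k‖²`, condition (i) says that `P(Δ)` kills every such `k`.

(i) ⇒ (ii): if the ball `B` of radius `r` about `t` lies in `Δ`, then on such `k` the resolvent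
agrees with its restriction to the range of `P(Bᶜ)`. At `t + ir` this restriction has norm below
`1/r` (`norm_resolvent_mul_proj_le`), so its Neumann series there converges at `t`. The local
continuations glue (`AdmitsAnalyticContinuation.of_local`).

(ii) ⇒ (i): `Im ⟪k, R(t+iε) k⟫ = ε ‖R(t+iε) k‖²` changes sign with `ε`, so for a continuation across
`t` it tends to `0`. The bound `‖P([t-ε, t+ε]) k‖² ≤ 2ε Im ⟪k, R(t+iε) k⟫` then makes the scalar
measure of small intervals `o(ε)` at each point of `Δ`, and differentiation of measures shows that
`Δ` is null.

The spectral measure is tied to `T` only by its domain and quadratic form. Commutation with `T` and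
the norm bounds on spectral subspaces are derived from these by polarization, without a functional
calculus. -/

/-! ### Spectral projections and their scalar measures. -/

namespace OrthogonalSpectralMeasure

variable {K : Type*} [NormedAddCommGroup K] [InnerProductSpace ℂ K] [CompleteSpace K]
  (P : OrthogonalSpectralMeasure K)

theorem scalarMeasure_apply {s : Set ℝ} (hs : MeasurableSet s) (x : K) :
    P.scalarMeasure x s = ENNReal.ofReal (‖P.proj s x‖ ^ 2) := by
  rw [scalarMeasure, Measure.ofMeasurable_apply s hs, P.inner_proj_self hs]

instance isFiniteMeasure_scalarMeasure (x : K) : IsFiniteMeasure (P.scalarMeasure x) :=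
  ⟨by rw [P.scalarMeasure_apply MeasurableSet.univ]; exact ENNReal.ofReal_lt_top⟩

theorem scalarMeasure_real_univ (x : K) : (P.scalarMeasure x).real Set.univ = ‖x‖ ^ 2 := by
  rw [Measure.real, P.scalarMeasure_apply MeasurableSet.univ, P.proj_univ,
    ENNReal.toReal_ofReal (by positivity), one_apply_eq_self]

theorem proj_proj_apply {s t : Set ℝ} (hs : MeasurableSet s) (ht : MeasurableSet t) (x : K) :
    P.proj s (P.proj t x) = P.proj (s ∩ t) x := by
  rw [P.proj_inter s t hs ht]; rfl

/-- This is what makes spectral projections preserve the domain and lets integrals split over `s`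
and `sᶜ`. -/
theorem scalarMeasure_proj {s : Set ℝ} (hs : MeasurableSet s) (x : K) :
    P.scalarMeasure (P.proj s x) = (P.scalarMeasure x).restrict s := by
  ext t ht
  rw [Measure.restrict_apply ht, P.scalarMeasure_apply ht, P.scalarMeasure_apply (ht.inter hs),
    P.proj_proj_apply ht hs]

theorem inner_proj_left {s : Set ℝ} (hs : MeasurableSet s) (x y : K) :
    ⟪P.proj s x, y⟫_ℂ = ⟪x, P.proj s y⟫_ℂ := by
  have h : ContinuousLinearMap.adjoint (P.proj s) = P.proj s :=
    (P.isStarProjection s hs).isSelfAdjoint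
  conv_lhs => rw [← h]
  exact ContinuousLinearMap.adjoint_inner_left _ _ _

theorem proj_union {s t : Set ℝ} (hs : MeasurableSet s) (ht : MeasurableSet t)
    (hd : Disjoint s t) (x : K) : P.proj (s ∪ t) x = P.proj s x + P.proj t x := by
  let f : ℕ → Set ℝ := fun n => if n = 0 then s else if n = 1 then t else ∅
  have hU : ⋃ n, f n = s ∪ t := by
    ext a
    simp only [Set.mem_iUnion, Set.mem_union]
    constructor
    · rintro ⟨n, hn⟩
      by_cases h0 : n = 0
      · exact Or.inl (by simpa [f, h0] using hn)
      · by_cases h1 : n = 1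
        · exact Or.inr (by simpa [f, h1] using hn)
        · simp [f, h0, h1] at hn
    · rintro (h | h)
      · exact ⟨0, by simpa [f] using h⟩
      · exact ⟨1, by simpa [f] using h⟩
  have h1 := P.hasSum_proj f (fun i => by
      by_cases h0 : i = 0
      · simpa [f, h0] using hs
      · by_cases h1 : i = 1 <;> simp [f, h0, h1, ht])
    (fun i j hij => by
      simp only [Function.onFun, f]
      split_ifs <;> first | omega | simp [hd.symm]) x
  have h2 : HasSum (fun i => P.proj (f i) x) (∑ i ∈ Finset.range 2, P.proj (f i) x) := by
    refine hasSum_sum_of_ne_finset_zero fun b hb => ?_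
    have : 2 ≤ b := by simpa [Nat.succ_le_iff] using hb
    simp [f, show b ≠ 0 by omega, show b ≠ 1 by omega, P.proj_empty]
  rw [hU] at h1
  simpa [Finset.sum_range_succ, f] using h1.unique h2

theorem proj_add_proj_compl {s : Set ℝ} (hs : MeasurableSet s) (x : K) :
    P.proj s x + P.proj sᶜ x = x := by
  rw [← P.proj_union hs hs.compl disjoint_compl_right, Set.union_compl_self, P.proj_univ]
  rfl

theorem proj_compl_apply {s : Set ℝ} (hs : MeasurableSet s) (x : K) :
    P.proj sᶜ x = x - P.proj s x :=
  eq_sub_of_add_eq' (P.proj_add_proj_compl hs x)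

theorem norm_proj_apply_le {s : Set ℝ} (hs : MeasurableSet s) (x : K) : ‖P.proj s x‖ ≤ ‖x‖ := by
  have h : P.scalarMeasure x s ≤ P.scalarMeasure x Set.univ := measure_mono (Set.subset_univ s)
  rw [P.scalarMeasure_apply hs, P.scalarMeasure_apply MeasurableSet.univ, P.proj_univ,
    ENNReal.ofReal_le_ofReal_iff (by positivity)] at h
  exact le_of_sq_le_sq h (norm_nonneg _)

theorem proj_eq_zero_of_subset {s t : Set ℝ} (hs : MeasurableSet s) (ht : MeasurableSet t)
    (hst : s ⊆ t) {x : K} (hx : P.proj t x = 0) : P.proj s x = 0 := by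
  rw [← Set.inter_eq_left.2 hst, ← P.proj_proj_apply hs ht, hx, map_zero]

theorem ae_mem_of_proj_eq {s : Set ℝ} (hs : MeasurableSet s) {x : K} (hx : P.proj s x = x) :
    ∀ᵐ t ∂P.scalarMeasure x, t ∈ s := by
  rw [← hx, P.scalarMeasure_proj hs]
  exact ae_restrict_mem hs

end OrthogonalSpectralMeasure

/-! ### Resolvents in terms of the graph. -/

section ResolventGraph

variable {K : Type*} [NormedAddCommGroup K] [InnerProductSpace ℂ K] {T : K →ₗ.[ℂ] K}

/-- Pairs in the graph can be added, scaled and projected without carrying domain proofs; later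
arguments use this form. -/
theorem isResolventAt_iff_graph {z : ℂ} {R : K →L[ℂ] K} :
    IsResolventAt T z R ↔ (∀ y, (R y, y + z • R y) ∈ T.graph) ∧
      ∀ x y, (x, y) ∈ T.graph → R (y - z • x) = x := by
  refine and_congr (forall_congr' fun y => ?_) ⟨fun h x y hx => ?_, fun h x => ?_⟩
  · rw [LinearPMap.mem_graph_iff]
    constructor
    · rintro ⟨h, hy⟩
      exact ⟨⟨R y, h⟩, rfl, sub_eq_iff_eq_add.1 hy⟩
    · rintro ⟨⟨u, hu⟩, h1, h2⟩
      dsimp only at h1 h2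
      subst h1
      exact ⟨hu, sub_eq_iff_eq_add.2 h2⟩
  · obtain ⟨x', rfl, rfl⟩ := T.mem_graph_iff.1 hx
    exact h x'
  · exact h _ _ (T.mem_graph x)

/-- The first resolvent identity. -/
theorem IsResolventAt.sub_eq_smul_mul {z w : ℂ} {R S : K →L[ℂ] K} (hR : IsResolventAt T z R)
    (hS : IsResolventAt T w S) : R - S = (z - w) • (R * S) := by
  ext y
  have h := (isResolventAt_iff_graph.1 hR).2 _ _ ((isResolventAt_iff_graph.1 hS).1 y)
  have e : y + w • S y - z • S y = y - (z - w) • S y := by module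
  rw [e, map_sub, map_smul, sub_eq_iff_eq_add] at h
  change R y - S y = (z - w) • R (S y)
  rw [h, add_sub_cancel_left]

end ResolventGraph

/-! ### Self-adjoint operators: estimates and existence of the resolvent. -/

section SymmetricGraph

variable {K : Type*} [NormedAddCommGroup K] [InnerProductSpace ℂ K] [CompleteSpace K]
  {T : K →ₗ.[ℂ] K}

theorem IsSelfAdjoint.inner_graph (hT : IsSelfAdjoint T) {x y u v : K} (hx : (x, y) ∈ T.graph)
    (hu : (u, v) ∈ T.graph) : ⟪y, u⟫_ℂ = ⟪x, v⟫_ℂ := by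
  obtain ⟨x', rfl, rfl⟩ := T.mem_graph_iff.1 hx
  obtain ⟨u', rfl, rfl⟩ := T.mem_graph_iff.1 hu
  have h := LinearPMap.adjoint_isFormalAdjoint hT.dense_domain
  rw [LinearPMap.isSelfAdjoint_def.1 hT] at h
  exact h x' u'

/-- This is the inclusion `T* ⊆ T`, the half of self-adjointness that goes beyond symmetry. -/
theorem IsSelfAdjoint.mem_graph_of_inner (hT : IsSelfAdjoint T) {v w : K}
    (h : ∀ x y, (x, y) ∈ T.graph → ⟪w, x⟫_ℂ = ⟪v, y⟫_ℂ) : (v, w) ∈ T.graph := by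
  have h' : ∀ x : T.domain, ⟪w, (x : K)⟫_ℂ = ⟪v, T x⟫_ℂ := fun x => h _ _ (T.mem_graph x)
  have hv := LinearPMap.mem_adjoint_domain_of_exists v ⟨w, h'⟩
  have hw := LinearPMap.adjoint_apply_eq hT.dense_domain ⟨v, hv⟩ h'
  rw [← LinearPMap.isSelfAdjoint_def.1 hT]
  exact (LinearPMap.mem_graph_iff _).2 ⟨⟨v, hv⟩, rfl, hw⟩

theorem IsSelfAdjoint.eq_zero_of_inner_domain (hT : IsSelfAdjoint T) {w : K}
    (h : ∀ x y, (x, y) ∈ T.graph → ⟪x, w⟫_ℂ = 0) : w = 0 := by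
  refine hT.dense_domain.eq_zero_of_inner_right ℂ fun x hx => ?_
  exact h x (T ⟨x, hx⟩) (T.mem_graph ⟨x, hx⟩)

theorem IsSelfAdjoint.im_inner_graph (hT : IsSelfAdjoint T) {x y : K} (hx : (x, y) ∈ T.graph) :
    (⟪x, y⟫_ℂ).im = 0 := by
  have h := hT.inner_graph hx hx
  rw [← inner_conj_symm] at h
  exact Complex.conj_eq_iff_im.1 h

/-- `Im ⟪(T - z) x, x⟫ = Im z ‖x‖²`. -/
theorem IsSelfAdjoint.im_inner_sub_smul (hT : IsSelfAdjoint T) {x y : K}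
    (hx : (x, y) ∈ T.graph) (z : ℂ) : (⟪y - z • x, x⟫_ℂ).im = z.im * ‖x‖ ^ 2 := by
  have h : ⟪y, x⟫_ℂ = ⟪x, y⟫_ℂ := hT.inner_graph hx hx
  rw [inner_sub_left, inner_smul_left, h, inner_self_eq_norm_sq_to_K, Complex.sub_im,
    hT.im_inner_graph hx]
  simp [← Complex.ofReal_pow]

theorem IsSelfAdjoint.abs_im_mul_norm_le (hT : IsSelfAdjoint T) {x y : K}
    (hx : (x, y) ∈ T.graph) (z : ℂ) : |z.im| * ‖x‖ ≤ ‖y - z • x‖ := by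
  rcases eq_or_ne x 0 with rfl | h0
  · simp
  have h1 : |z.im| * ‖x‖ ^ 2 ≤ ‖y - z • x‖ * ‖x‖ := by
    rw [← abs_of_nonneg (sq_nonneg ‖x‖), ← abs_mul, ← hT.im_inner_sub_smul hx z]
    exact (Complex.abs_im_le_norm _).trans (norm_inner_le_norm _ _)
  have : 0 < ‖x‖ := norm_pos_iff.2 h0
  nlinarith

/-- `‖(T - z) x‖² = ‖(T - Re z) x‖² + (Im z)² ‖x‖²`. -/
theorem IsSelfAdjoint.norm_sub_smul_sq (hT : IsSelfAdjoint T) {x y : K}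
    (hx : (x, y) ∈ T.graph) (a b : ℝ) :
    ‖y - (a + b * Complex.I : ℂ) • x‖ ^ 2 = ‖y - (a : ℂ) • x‖ ^ 2 + b ^ 2 * ‖x‖ ^ 2 := by
  have h : (⟪y - (a : ℂ) • x, x⟫_ℂ).im = 0 := by simpa using hT.im_inner_sub_smul hx a
  have e : y - (a + b * Complex.I : ℂ) • x = (y - (a : ℂ) • x) - (b * Complex.I : ℂ) • x := by
    module
  rw [Complex.coe_smul] at h
  rw [e, @norm_sub_sq ℂ, inner_smul_right, norm_smul]
  simp [h, mul_pow]

/-- Non-real points are regular points of a self-adjoint operator. -/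
theorem IsSelfAdjoint.exists_isResolventAt (hT : IsSelfAdjoint T) {z : ℂ} (hz : z.im ≠ 0) :
    ∃ R : K →L[ℂ] K, IsResolventAt T z R := by
  have hz' : 0 < |z.im| := abs_pos.2 hz
  -- `T - z` viewed as a bounded map on the graph, which is complete because `T` is closed; being
  -- bounded below, it is injective with closed range.
  let L : T.graph →L[ℂ] K :=
    (ContinuousLinearMap.snd ℂ K K - z • ContinuousLinearMap.fst ℂ K K) ∘L T.graph.subtypeL
  have hL : ∀ p : T.graph, L p = p.1.2 - z • p.1.1 := fun p => rfl
  have hbd : ∀ p : T.graph, ‖p‖ ≤ (1 + (1 + ‖z‖) / |z.im|) * ‖L p‖ := by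
    rintro ⟨⟨x, y⟩, hp⟩
    have h1 : ‖x‖ ≤ ‖y - z • x‖ / |z.im| := by
      rw [le_div_iff₀ hz', mul_comm]; exact hT.abs_im_mul_norm_le hp z
    have h2 : ‖y‖ ≤ ‖y - z • x‖ + ‖z‖ * ‖x‖ := by
      rw [← norm_smul]
      simpa using norm_add_le (y - z • x) (z • x)
    have h3 : ‖z‖ * ‖x‖ ≤ ‖z‖ * (‖y - z • x‖ / |z.im|) := by gcongr
    have h4 : 0 ≤ ‖z‖ * (‖y - z • x‖ / |z.im|) := by positivity
    have h5 : 0 ≤ ‖y - z • x‖ / |z.im| := by positivity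
    have h6 : (1 + (1 + ‖z‖) / |z.im|) * ‖y - z • x‖ =
      ‖y - z • x‖ + ‖y - z • x‖ / |z.im| + ‖z‖ * (‖y - z • x‖ / |z.im|) := by ring
    have h7 := norm_nonneg (y - z • x)
    rw [hL, Submodule.coe_norm, Prod.norm_def]
    dsimp only
    rw [h6]
    exact max_le (by linarith) (by linarith)
  have hcl : IsClosed (T.graph : Set (K × K)) := hT.isClosed
  have : CompleteSpace T.graph := hcl.completeSpace_coe
  have hanti : AntilipschitzWith (Real.toNNReal (1 + (1 + ‖z‖) / |z.im|)) L := by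
    refine ContinuousLinearMap.antilipschitz_of_bound L fun p => ?_
    rw [Real.coe_toNNReal _ (by positivity)]
    exact hbd p
  have hker : L.ker = ⊥ := LinearMap.ker_eq_bot.2 hanti.injective
  have hclr : IsClosed (L.range : Set K) := by
    rw [LinearMap.coe_range]
    exact hanti.isClosed_range L.uniformContinuous
  have hrange : L.range = ⊤ := by
    have : CompleteSpace L.range := hclr.completeSpace_coe
    rw [← Submodule.orthogonal_eq_bot_iff, Submodule.eq_bot_iff]
    intro w hw
    -- A vector orthogonal to the range is an eigenvector for the non-real number `conj z`, hence
    -- zero.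
    have hg : (w, (starRingEnd ℂ z) • w) ∈ T.graph := by
      refine hT.mem_graph_of_inner fun x y hx => ?_
      have h := (Submodule.mem_orthogonal' _ _).1 hw (L ⟨(x, y), hx⟩) ⟨_, rfl⟩
      rw [hL, inner_sub_right, inner_smul_right, sub_eq_zero] at h
      rw [inner_smul_left, Complex.conj_conj, h]
    have h := hT.abs_im_mul_norm_le hg (starRingEnd ℂ z)
    rw [sub_self, norm_zero, Complex.conj_im, abs_neg] at h
    exact norm_le_zero_iff.1 (by nlinarith [norm_nonneg w])
  let e := ContinuousLinearEquiv.ofBijective L hker hrange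
  have he : ∀ p, e p = L p := fun p => rfl
  refine ⟨ContinuousLinearMap.fst ℂ K K ∘L T.graph.subtypeL ∘L (e.symm : K →L[ℂ] T.graph),
    isResolventAt_iff_graph.2 ⟨fun y => ?_, fun x y hx => ?_⟩⟩
  · have h := e.apply_symm_apply y
    rw [he, hL, sub_eq_iff_eq_add] at h
    change ((e.symm y).1.1, y + z • (e.symm y).1.1) ∈ T.graph
    rw [← h]
    exact (e.symm y).2
  · change (e.symm (y - z • x)).1.1 = x
    have : y - z • x = e ⟨(x, y), hx⟩ := rfl
    rw [this, e.symm_apply_apply]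

theorem IsSelfAdjoint.isResolventAt_operatorResolvent (hT : IsSelfAdjoint T) {z : ℂ}
    (hz : z.im ≠ 0) : IsResolventAt T z (operatorResolvent T z) := by
  have h := hT.exists_isResolventAt hz
  rw [operatorResolvent, dif_pos h]
  exact h.choose_spec

end SymmetricGraph

/-! ### Commutation with spectral projections and bounds on spectral subspaces. -/

namespace OrthogonalSpectralMeasure.IsSpectralMeasureOf

variable {K : Type*} [NormedAddCommGroup K] [InnerProductSpace ℂ K] [CompleteSpace K]
  {P : OrthogonalSpectralMeasure K} {T : K →ₗ.[ℂ] K}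

theorem integrable_sq (hP : P.IsSpectralMeasureOf T) {x y : K} (hx : (x, y) ∈ T.graph) :
    Integrable (fun t : ℝ => t ^ 2) (P.scalarMeasure x) :=
  (hP.1 x).1 (T.mem_domain_of_mem_graph hx)

theorem integrable_id (hP : P.IsSpectralMeasureOf T) {x y : K} (hx : (x, y) ∈ T.graph) :
    Integrable (fun t : ℝ => t) (P.scalarMeasure x) := by
  refine ((integrable_const (1 : ℝ)).add (hP.integrable_sq hx)).mono'
    measurable_id.aestronglyMeasurable (ae_of_all _ fun t => ?_)
  rw [Real.norm_eq_abs, Pi.add_apply, ← sq_abs t]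
  nlinarith [sq_nonneg (|t| - 1), abs_nonneg t]

theorem inner_graph (hP : P.IsSpectralMeasureOf T) {x y : K} (hx : (x, y) ∈ T.graph) :
    ⟪x, y⟫_ℂ = ((∫ t : ℝ, t ∂(P.scalarMeasure x) : ℝ) : ℂ) := by
  obtain ⟨x', rfl, rfl⟩ := T.mem_graph_iff.1 hx
  exact hP.2 x'

theorem exists_proj_mem_graph (hP : P.IsSpectralMeasureOf T) {s : Set ℝ} (hs : MeasurableSet s)
    {x y : K} (hx : (x, y) ∈ T.graph) : ∃ v, (P.proj s x, v) ∈ T.graph := by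
  have h : P.proj s x ∈ T.domain := by
    rw [hP.1, P.scalarMeasure_proj hs]
    exact (hP.integrable_sq hx).restrict
  exact ⟨T ⟨_, h⟩, T.mem_graph ⟨_, h⟩⟩

/-- The quadratic form at `P(s)u + P(sᶜ)v` is an integral that splits over `s` and `sᶜ`, so the
cross terms cancel. By symmetry of `T` they amount to twice this real part. -/
theorem re_inner_proj_compl (hT : IsSelfAdjoint T) (hP : P.IsSpectralMeasureOf T) {s : Set ℝ}
    (hs : MeasurableSet s) {u v a b : K} (ha : (P.proj s u, a) ∈ T.graph)
    (hb : (P.proj sᶜ v, b) ∈ T.graph) : (⟪P.proj s u, b⟫_ℂ).re = 0 := by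
  have hx : (P.proj s u + P.proj sᶜ v, a + b) ∈ T.graph := T.graph.add_mem ha hb
  have e1 : P.proj s (P.proj s u + P.proj sᶜ v) = P.proj s u := by
    rw [map_add, P.proj_proj_apply hs hs, P.proj_proj_apply hs hs.compl, Set.inter_self,
      Set.inter_compl_self, P.proj_empty]
    simp
  have e2 : P.proj sᶜ (P.proj s u + P.proj sᶜ v) = P.proj sᶜ v := by
    rw [map_add, P.proj_proj_apply hs.compl hs, P.proj_proj_apply hs.compl hs.compl,
      Set.inter_self, Set.compl_inter_self, P.proj_empty]
    simp
  have h1 := hP.inner_graph hx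
  rw [← integral_add_compl hs (hP.integrable_id hx), ← P.scalarMeasure_proj hs,
    ← P.scalarMeasure_proj hs.compl, e1, e2, Complex.ofReal_add, ← hP.inner_graph ha,
    ← hP.inner_graph hb, inner_add_left, inner_add_right, inner_add_right,
    ← hT.inner_graph hb ha, ← inner_conj_symm b] at h1
  have h2 := congrArg Complex.re h1
  simp only [Complex.add_re, Complex.conj_re] at h2
  linarith

/-- Replacing `v` by `iv` upgrades the vanishing real part to a vanishing inner product; testing on
the dense domain does the rest. -/
theorem proj_eq_zero_of_graph (hT : IsSelfAdjoint T) (hP : P.IsSpectralMeasureOf T) {s : Set ℝ}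
    (hs : MeasurableSet s) {v b : K} (hb : (P.proj sᶜ v, b) ∈ T.graph) : P.proj s b = 0 := by
  refine hT.eq_zero_of_inner_domain fun u w hu => ?_
  obtain ⟨a, ha⟩ := hP.exists_proj_mem_graph hs hu
  rw [← P.inner_proj_left hs]
  have h1 := re_inner_proj_compl hT hP hs ha hb
  have h2 := re_inner_proj_compl (v := Complex.I • v) (b := Complex.I • b) hT hP hs ha (by
    rw [map_smul]
    exact T.graph.smul_mem Complex.I hb)
  rw [inner_smul_right] at h2
  apply Complex.ext
  · simpa using h1
  · simpa using h2

/-- The spectral projections commute with the operator. -/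
theorem proj_mem_graph (hT : IsSelfAdjoint T) (hP : P.IsSpectralMeasureOf T) {s : Set ℝ}
    (hs : MeasurableSet s) {x y : K} (hx : (x, y) ∈ T.graph) :
    (P.proj s x, P.proj s y) ∈ T.graph := by
  obtain ⟨a, ha⟩ := hP.exists_proj_mem_graph hs hx
  obtain ⟨b, hb⟩ := hP.exists_proj_mem_graph hs.compl hx
  -- Here `a = T P(s)x` and `b = T P(sᶜ)x`; each stays in its own spectral subspace, so `P(s)`
  -- applied to `y = a + b` returns `a`.
  have hb0 := proj_eq_zero_of_graph hT hP hs hb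
  have ha0 : P.proj sᶜ a = 0 :=
    proj_eq_zero_of_graph (v := x) hT hP hs.compl (by rwa [compl_compl])
  have hab : (x, a + b) ∈ T.graph := by
    have := T.graph.add_mem ha hb
    rwa [Prod.mk_add_mk, P.proj_add_proj_compl hs] at this
  have hy : y = a + b := T.mem_graph_snd_inj hx hab rfl
  have ha1 : P.proj s a = a := by
    have := P.proj_add_proj_compl hs a
    rwa [ha0, add_zero] at this
  rwa [hy, map_add, hb0, add_zero, ha1]

/-- The spectral projections commute with the resolvent. -/
theorem proj_resolvent_comm (hT : IsSelfAdjoint T) (hP : P.IsSpectralMeasureOf T) {s : Set ℝ}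
    (hs : MeasurableSet s) {z : ℂ} {R : K →L[ℂ] K} (hR : IsResolventAt T z R) :
    R * P.proj s = P.proj s * R := by
  rw [isResolventAt_iff_graph] at hR
  ext y
  have h := hR.2 _ _ (proj_mem_graph hT hP hs (hR.1 y))
  rwa [map_add, map_smul, add_sub_cancel_right] at h

theorem re_inner_le (hP : P.IsSpectralMeasureOf T) {s : Set ℝ} (hs : MeasurableSet s) {b : ℝ}
    (hsb : ∀ t ∈ s, t ≤ b) {x y : K} (hx : (x, y) ∈ T.graph) (hsx : P.proj s x = x) :
    (⟪x, y⟫_ℂ).re ≤ b * ‖x‖ ^ 2 := by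
  rw [hP.inner_graph hx, Complex.ofReal_re, ← P.scalarMeasure_real_univ]
  calc _ ≤ ∫ _, b ∂P.scalarMeasure x := by
        refine integral_mono_ae (hP.integrable_id hx) (integrable_const _) ?_
        filter_upwards [P.ae_mem_of_proj_eq hs hsx] with t ht using hsb t ht
    _ = _ := by rw [integral_const, smul_eq_mul, mul_comm]

theorem le_re_inner (hP : P.IsSpectralMeasureOf T) {s : Set ℝ} (hs : MeasurableSet s) {a : ℝ}
    (hsa : ∀ t ∈ s, a ≤ t) {x y : K} (hx : (x, y) ∈ T.graph) (hsx : P.proj s x = x) :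
    a * ‖x‖ ^ 2 ≤ (⟪x, y⟫_ℂ).re := by
  rw [hP.inner_graph hx, Complex.ofReal_re, ← P.scalarMeasure_real_univ]
  calc _ = ∫ _, a ∂P.scalarMeasure x := by rw [integral_const, smul_eq_mul, mul_comm]
    _ ≤ _ := by
        refine integral_mono_ae (integrable_const _) (hP.integrable_id hx) ?_
        filter_upwards [P.ae_mem_of_proj_eq hs hsx] with t ht using hsa t ht

/-- `‖(T - a) x‖ ≤ r ‖x‖` on the spectral subspace of `[a - r, a + r]`. -/
theorem norm_sub_smul_le (hT : IsSelfAdjoint T) (hP : P.IsSpectralMeasureOf T) {a r : ℝ}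
    (hr : 0 < r) {x y : K} (hx : (x, y) ∈ T.graph)
    (hsx : P.proj (Metric.closedBall a r) x = x) : ‖y - (a : ℂ) • x‖ ≤ r * ‖x‖ := by
  have hs : MeasurableSet (Metric.closedBall a r) := measurableSet_closedBall
  have hmem : ∀ t ∈ Metric.closedBall a r, a - r ≤ t ∧ t ≤ a + r := fun t ht => by
    rwa [Real.closedBall_eq_Icc, Set.mem_Icc] at ht
  have hsy : P.proj (Metric.closedBall a r) y = y := by
    have h := proj_mem_graph hT hP hs hx
    rw [hsx] at h
    exact T.mem_graph_snd_inj h hx rfl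
  -- Polarization: compare the upper bound of the form at `x + w` with the lower bound at `x - w`.
  -- Because `(T - a)x = r w`, subtracting leaves `‖w‖ ≤ ‖x‖`.
  set w := (r⁻¹ : ℂ) • (y - (a : ℂ) • x) with hw
  have hsw : P.proj (Metric.closedBall a r) w = w := by
    rw [hw, map_smul, map_sub, map_smul, hsx, hsy]
  have hyw : y - (a : ℂ) • x = (r : ℂ) • w := by
    rw [hw, smul_smul, mul_inv_cancel₀ (by exact_mod_cast hr.ne'), one_smul]
  obtain ⟨v, hv⟩ : ∃ v, (w, v) ∈ T.graph := by
    -- The vector `y` lies in the spectral subspace of a bounded interval, where `t²` is integrable.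
    have hyd : y ∈ T.domain := by
      rw [hP.1, ← hsy, P.scalarMeasure_proj hs]
      refine Integrable.mono' (integrable_const ((|a| + r) ^ 2))
        (measurable_id.pow_const 2).aestronglyMeasurable ?_
      filter_upwards [ae_restrict_mem hs] with t ht
      have h := hmem t ht
      rw [Real.norm_eq_abs, abs_pow]
      refine pow_le_pow_left₀ (abs_nonneg t) (abs_le.2 ⟨?_, ?_⟩) 2
      · linarith [neg_abs_le a]
      · linarith [le_abs_self a]
    exact ⟨_, T.graph.smul_mem _ (T.graph.sub_mem (T.mem_graph ⟨y, hyd⟩)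
      (T.graph.smul_mem (a : ℂ) hx))⟩
  have h1 := hP.re_inner_le hs (fun t ht => (hmem t ht).2) (T.graph.add_mem hx hv)
    (by rw [map_add, hsx, hsw])
  have h2 := hP.le_re_inner hs (fun t ht => (hmem t ht).1) (T.graph.sub_mem hx hv)
    (by rw [map_sub, hsx, hsw])
  have hsym : (⟪x, v⟫_ℂ).re = (⟪w, y⟫_ℂ).re := by
    rw [← hT.inner_graph hx hv, ← inner_conj_symm, Complex.conj_re]
  have hy : y = (a : ℂ) • x + (r : ℂ) • w := by rw [← hyw, add_sub_cancel]
  have hwy : (⟪w, y⟫_ℂ).re = a * (⟪x, w⟫_ℂ).re + r * ‖w‖ ^ 2 := by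
    have : (⟪x, w⟫_ℂ).re = (⟪w, x⟫_ℂ).re := by rw [← inner_conj_symm, Complex.conj_re]
    rw [hy, inner_add_right, inner_smul_right, inner_smul_right, inner_self_eq_norm_sq_to_K, this]
    simp [← Complex.ofReal_pow]
  have n1 : ‖x + w‖ ^ 2 = ‖x‖ ^ 2 + 2 * (⟪x, w⟫_ℂ).re + ‖w‖ ^ 2 := @norm_add_sq ℂ _ _ _ _ x w
  have n2 : ‖x - w‖ ^ 2 = ‖x‖ ^ 2 - 2 * (⟪x, w⟫_ℂ).re + ‖w‖ ^ 2 := @norm_sub_sq ℂ _ _ _ _ x w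
  rw [n1, inner_add_left, inner_add_right, inner_add_right] at h1
  rw [n2, inner_sub_left, inner_sub_right, inner_sub_right] at h2
  simp only [Complex.add_re, Complex.sub_re] at h1 h2
  have h3 : r * ‖w‖ ^ 2 ≤ r * ‖x‖ ^ 2 := by linarith
  have h4 : ‖w‖ ≤ ‖x‖ := le_of_sq_le_sq (le_of_mul_le_mul_left h3 hr) (norm_nonneg _)
  rw [hyw, norm_smul, Complex.norm_real, Real.norm_of_nonneg hr.le]
  gcongr

/-- `r ‖x‖ ≤ ‖(T - a) x‖` on the spectral subspace of the complement of `(a - r, a + r)`. -/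
theorem le_norm_sub_smul (hT : IsSelfAdjoint T) (hP : P.IsSpectralMeasureOf T) {a r : ℝ}
    {x y : K} (hx : (x, y) ∈ T.graph)
    (hsx : P.proj (Metric.ball a r) x = 0) : r * ‖x‖ ≤ ‖y - (a : ℂ) • x‖ := by
  have hb : MeasurableSet (Metric.ball a r) := measurableSet_ball
  have hs : MeasurableSet (Set.Iio a) := measurableSet_Iio
  -- Split `x` at `a` and test `(T - a)x` against `p - m`, which plays the role of `sign(T - a) x`:
  -- it has the norm of `x`, and both halves contribute with the same sign.
  set p := P.proj (Set.Iio a)ᶜ x with hp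
  set m := P.proj (Set.Iio a) x with hm
  have hxpm : m + p = x := P.proj_add_proj_compl hs x
  have hpg := proj_mem_graph hT hP hs.compl hx
  have hmg := proj_mem_graph hT hP hs hx
  set q := P.proj (Set.Iio a)ᶜ y with hq
  set n := P.proj (Set.Iio a) y with hn
  have hynq : n + q = y := P.proj_add_proj_compl hs y
  have compl_fix : ∀ t : Set ℝ, MeasurableSet t →
      P.proj (Metric.ball a r)ᶜ (P.proj t x) = P.proj t x := fun t ht => by
    rw [P.proj_compl_apply hb, P.proj_proj_apply hb ht, Set.inter_comm,
      ← P.proj_proj_apply ht hb, hsx, map_zero, sub_zero]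
  have hpf : P.proj ((Metric.ball a r)ᶜ ∩ (Set.Iio a)ᶜ) p = p := by
    rw [← P.proj_proj_apply hb.compl hs.compl, hp, P.proj_proj_apply hs.compl hs.compl,
      Set.inter_self, compl_fix _ hs.compl]
  have hmf : P.proj ((Metric.ball a r)ᶜ ∩ Set.Iio a) m = m := by
    rw [← P.proj_proj_apply hb.compl hs, hm, P.proj_proj_apply hs hs, Set.inter_self,
      compl_fix _ hs]
  have hdist : ∀ t ∈ (Metric.ball a r)ᶜ, r ≤ |t - a| := fun t ht => by
    simpa [Real.dist_eq] using ht
  have h1 : (a + r) * ‖p‖ ^ 2 ≤ (⟪p, q⟫_ℂ).re := by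
    refine hP.le_re_inner (hb.compl.inter hs.compl) (fun t ht => ?_) hpg hpf
    have h := hdist t ht.1
    have h' : a ≤ t := by simpa using ht.2
    rw [abs_of_nonneg (by linarith)] at h
    linarith
  have h2 : (⟪m, n⟫_ℂ).re ≤ (a - r) * ‖m‖ ^ 2 := by
    refine hP.re_inner_le (hb.compl.inter hs) (fun t ht => ?_) hmg hmf
    have h := hdist t ht.1
    have h' : t < a := ht.2
    rw [abs_of_nonpos (by linarith)] at h
    linarith
  have orth : ∀ u v : K, ⟪P.proj (Set.Iio a) u, P.proj (Set.Iio a)ᶜ v⟫_ℂ = 0 := fun u v => by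
    rw [P.inner_proj_left hs, P.proj_proj_apply hs hs.compl, Set.inter_compl_self, P.proj_empty]
    simp
  have orth' : ∀ u v : K, ⟪P.proj (Set.Iio a)ᶜ u, P.proj (Set.Iio a) v⟫_ℂ = 0 := fun u v => by
    rw [← inner_conj_symm, orth, map_zero]
  have hmp : ⟪m, p⟫_ℂ = 0 := orth _ _
  have hpm : ⟪p, m⟫_ℂ = 0 := orth' _ _
  have hmq : ⟪m, q⟫_ℂ = 0 := orth _ _
  have hpn : ⟪p, n⟫_ℂ = 0 := orth' _ _
  have nx : ‖x‖ ^ 2 = ‖m‖ ^ 2 + ‖p‖ ^ 2 := by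
    rw [← hxpm, @norm_add_sq ℂ, hmp]; simp
  have nu : ‖p - m‖ ^ 2 = ‖m‖ ^ 2 + ‖p‖ ^ 2 := by
    rw [@norm_sub_sq ℂ, hpm]; simp [add_comm]
  have nu' : ‖p - m‖ = ‖x‖ := by
    rw [← sq_eq_sq₀ (norm_nonneg _) (norm_nonneg _), nu, nx]
  have hin : (⟪p - m, y - (a : ℂ) • x⟫_ℂ).re =
      (⟪p, q⟫_ℂ).re - (⟪m, n⟫_ℂ).re - a * ‖p‖ ^ 2 + a * ‖m‖ ^ 2 := by
    rw [← hxpm, ← hynq]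
    simp only [inner_sub_left, inner_sub_right, inner_add_right, inner_smul_right, hmp, hpm, hmq,
      hpn, inner_self_eq_norm_sq_to_K]
    simp [← Complex.ofReal_pow]
    ring
  have h3 : (⟪p - m, y - (a : ℂ) • x⟫_ℂ).re ≤ ‖x‖ * ‖y - (a : ℂ) • x‖ := by
    rw [← nu']
    exact (Complex.re_le_norm _).trans (norm_inner_le_norm _ _)
  have h4 : r * ‖x‖ ^ 2 ≤ ‖x‖ * ‖y - (a : ℂ) • x‖ := by
    rw [nx]; linarith
  rcases (norm_nonneg x).eq_or_lt with h0 | h0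
  · rw [← h0, mul_zero]; exact norm_nonneg _
  · nlinarith

end OrthogonalSpectralMeasure.IsSpectralMeasureOf

/-! ### Gluing analytic continuations and Neumann series. -/

section Continuation

open Filter Topology

variable {H : Type*} [NormedAddCommGroup H] [InnerProductSpace ℂ H]

theorem neBot_nhdsWithin_im_ne_zero {z : ℂ} (hz : z.im = 0) : (𝓝[{w : ℂ | w.im ≠ 0}] z).NeBot := by
  refine mem_closure_iff_nhdsWithin_neBot.1
    (closure_mono (s := {w : ℂ | 0 < w.im}) (fun w hw => ne_of_gt hw) ?_)
  rw [Complex.closure_setOfPred_lt_im]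
  exact hz.ge

/-- Local analytic continuations across the points of `Δ` glue. -/
theorem AdmitsAnalyticContinuation.of_local [CompleteSpace H] {R : ℂ → H →L[ℂ] H} {Δ : Set ℝ}
    (hR : ∀ z : ℂ, z.im ≠ 0 → AnalyticAt ℂ R z)
    (hΔ : ∀ t ∈ Δ, ∃ G : ℂ → H →L[ℂ] H, AnalyticAt ℂ G (t : ℂ) ∧
      ∀ᶠ z in 𝓝 (t : ℂ), z.im ≠ 0 → G z = R z) :
    AdmitsAnalyticContinuation R Δ := by
  classical
  -- At a real point the value is the limit from non-real points, so it does not depend on a local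
  -- continuation; real points without such a limit get a junk value.
  refine ⟨fun z => if z.im ≠ 0 then R z else limUnder (𝓝[{w : ℂ | w.im ≠ 0}] z) R, ?_,
    fun z hz => if_pos hz⟩
  rintro z (hz | ⟨t, ht, rfl⟩)
  · refine (hR z hz).congr ?_
    have : ∀ᶠ w : ℂ in 𝓝 z, w.im ≠ 0 := Complex.continuous_im.continuousAt.eventually_ne hz
    filter_upwards [this] with w hw
    exact (if_pos hw).symm
  · obtain ⟨G, hG, hGR⟩ := hΔ t ht
    refine hG.congr ?_
    -- Agreement is needed at real points near `t` as well; there `G` is continuous and equals `R`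
    -- at the nearby non-real points.
    filter_upwards [hG.eventually_analyticAt, hGR.eventually_nhds] with z hz1 hz2
    by_cases hz : z.im = 0
    · have := neBot_nhdsWithin_im_ne_zero hz
      rw [if_neg (not_not.2 hz)]
      refine (Tendsto.limUnder_eq ?_).symm
      refine (hz1.continuousAt.tendsto.mono_left nhdsWithin_le_nhds).congr' ?_
      exact eventually_nhdsWithin_iff.2 hz2
    · rw [if_pos hz]
      exact hz2.self_of_nhds hz

/-- A pseudo-resolvent identity at one base point propagates to a Neumann series. -/
theorem analyticAt_mul_inverse_one_sub_smul {𝓐 : Type*} [NormedRing 𝓐] [NormedAlgebra ℂ 𝓐]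
    [CompleteSpace 𝓐] {B : 𝓐} {z₀ a : ℂ} (h : ‖a - z₀‖ * ‖B‖ < 1) :
    AnalyticAt ℂ (fun z => B * Ring.inverse (1 - (z - z₀) • B)) a ∧
      ∀ᶠ z in 𝓝 a, ∀ C : 𝓐, C - B = (z - z₀) • (C * B) → B * Ring.inverse (1 - (z - z₀) • B) = C := by
  have hlt : ∀ z : ℂ, ‖z - z₀‖ * ‖B‖ < 1 → IsUnit (1 - (z - z₀) • B) := fun z hz =>
    isUnit_one_sub_of_norm_lt_one (by rwa [norm_smul])
  constructor
  · obtain ⟨u, hu⟩ := hlt a h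
    have h1 : AnalyticAt ℂ (fun z : ℂ => 1 - (z - z₀) • B) a :=
      analyticAt_const.sub ((analyticAt_id.sub analyticAt_const).smul analyticAt_const)
    have h2 : AnalyticAt ℂ Ring.inverse (1 - (a - z₀) • B) := hu ▸ analyticAt_inverse u
    exact analyticAt_const.mul (h2.comp (f := fun z : ℂ => 1 - (z - z₀) • B) h1)
  · have hc : ContinuousAt (fun z : ℂ => ‖z - z₀‖ * ‖B‖) a := by fun_prop
    filter_upwards [hc.eventually_lt continuousAt_const h] with z hz C hC
    have h1 : C * (1 - (z - z₀) • B) = B := by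
      rw [mul_sub, mul_one, mul_smul_comm, ← hC, sub_sub_cancel]
    calc _ = C * (1 - (z - z₀) • B) * Ring.inverse (1 - (z - z₀) • B) := by rw [h1]
      _ = C := by rw [mul_assoc, Ring.mul_inverse_cancel _ (hlt z hz), mul_one]

end Continuation

/-! ### Resolvents cut down by spectral projections. -/

namespace OrthogonalSpectralMeasure.IsSpectralMeasureOf

open Filter Topology

variable {K : Type*} [NormedAddCommGroup K] [InnerProductSpace ℂ K] [CompleteSpace K]
  {P : OrthogonalSpectralMeasure K} {T : K →ₗ.[ℂ] K}

/-- The first resolvent identity survives multiplication by an idempotent that commutes with the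
resolvent. -/
theorem resolvent_mul_proj_sub (hT : IsSelfAdjoint T) (hP : P.IsSpectralMeasureOf T) {s : Set ℝ}
    (hs : MeasurableSet s) {z w : ℂ} {R S : K →L[ℂ] K} (hR : IsResolventAt T z R)
    (hS : IsResolventAt T w S) :
    R * P.proj s - S * P.proj s = (z - w) • (R * P.proj s * (S * P.proj s)) := by
  have hc := proj_resolvent_comm hT hP hs hS
  have hid : P.proj s * P.proj s = P.proj s := (P.isStarProjection s hs).isIdempotentElem
  have e : R * P.proj s * (S * P.proj s) = R * S * P.proj s := by
    rw [mul_assoc, ← mul_assoc (P.proj s), ← hc, mul_assoc S, hid, mul_assoc]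
  rw [e, ← sub_mul, hR.sub_eq_smul_mul hS, smul_mul_assoc]

/-- On this subspace `‖(T - a - ir)v‖² = ‖(T - a)v‖² + r²‖v‖² ≥ 2r²‖v‖²`, giving the bound `1/(√2
r)`. The rational `4/5` exceeds `1/√2` and is still below `1`, as the Neumann series requires. -/
theorem norm_resolvent_mul_proj_le (hT : IsSelfAdjoint T) (hP : P.IsSpectralMeasureOf T)
    {a r : ℝ} (hr : 0 < r) {R : K →L[ℂ] K} (hR : IsResolventAt T (a + r * Complex.I) R) :
    ‖R * P.proj (Metric.ball a r)ᶜ‖ ≤ 4 / (5 * r) := by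
  have hb : MeasurableSet (Metric.ball a r) := measurableSet_ball
  refine ContinuousLinearMap.opNorm_le_bound _ (by positivity) fun y => ?_
  set u := P.proj (Metric.ball a r)ᶜ y with hu
  change ‖R u‖ ≤ _
  have hg := (isResolventAt_iff_graph.1 hR).1 u
  have h0 : P.proj (Metric.ball a r) (R u) = 0 := by
    have h := congrArg (fun S : K →L[ℂ] K => S u) (proj_resolvent_comm hT hP hb hR)
    change R (P.proj _ u) = P.proj _ (R u) at h
    rw [← h, hu, P.proj_proj_apply hb hb.compl, Set.inter_compl_self, P.proj_empty]
    simp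
  have h1 := le_norm_sub_smul hT hP hg h0
  have h2 := hT.norm_sub_smul_sq hg a r
  rw [add_sub_cancel_right] at h2
  have h3 : ‖u‖ ≤ ‖y‖ := P.norm_proj_apply_le hb.compl y
  have h4 : (r * ‖R u‖) ^ 2 ≤ ‖u + (a + r * Complex.I : ℂ) • R u - (a : ℂ) • R u‖ ^ 2 := by
    gcongr
  have h5 : (5 / 4 * (r * ‖R u‖)) ^ 2 ≤ ‖u‖ ^ 2 := by nlinarith [sq_nonneg (r * ‖R u‖)]
  have h6 : 5 / 4 * (r * ‖R u‖) ≤ ‖u‖ := le_of_sq_le_sq h5 (norm_nonneg _)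
  rw [div_mul_eq_mul_div, le_div_iff₀ (by positivity)]
  linarith

/-- The resolvent restricted to the spectral subspace of `s` continues analytically to `a` if it is
small enough at some `z₀`. -/
theorem exists_analyticAt_resolvent_mul_proj (hT : IsSelfAdjoint T)
    (hP : P.IsSpectralMeasureOf T) {s : Set ℝ} (hs : MeasurableSet s) {z₀ a : ℂ}
    (hz₀ : z₀.im ≠ 0) (h : ‖a - z₀‖ * ‖operatorResolvent T z₀ * P.proj s‖ < 1) :
    ∃ G : ℂ → K →L[ℂ] K, AnalyticAt ℂ G a ∧
      ∀ᶠ z in 𝓝 a, z.im ≠ 0 → G z = operatorResolvent T z * P.proj s := by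
  obtain ⟨h1, h2⟩ := analyticAt_mul_inverse_one_sub_smul h
  refine ⟨_, h1, ?_⟩
  filter_upwards [h2] with z hz hzim
  exact hz _ (resolvent_mul_proj_sub hT hP hs (hT.isResolventAt_operatorResolvent hzim)
    (hT.isResolventAt_operatorResolvent hz₀))

/-- The mass of `[a - ε, a + ε]` is controlled by the resolvent at `a + iε`. -/
theorem norm_proj_closedBall_sq_le (hT : IsSelfAdjoint T) (hP : P.IsSpectralMeasureOf T)
    {a ε : ℝ} (hε : 0 < ε) {R : K →L[ℂ] K} (hR : IsResolventAt T (a + ε * Complex.I) R) (k : K) :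
    ‖P.proj (Metric.closedBall a ε) k‖ ^ 2 ≤ 2 * ε * (⟪k, R k⟫_ℂ).im := by
  have hs : MeasurableSet (Metric.closedBall a ε) := measurableSet_closedBall
  have hg := (isResolventAt_iff_graph.1 hR).1 k
  have hpg := proj_mem_graph hT hP hs hg
  -- With `p = P([a-ε, a+ε]) R k`, the left side is `‖(T - a)p‖² + ε²‖p‖² ≤ 2ε²‖R k‖²`, and `ε‖R k‖²
  -- = Im ⟪k, R k⟫`.
  have h1 := hT.norm_sub_smul_sq hpg a ε
  have h2 := norm_sub_smul_le hT hP hε hpg (by rw [P.proj_proj_apply hs hs, Set.inter_self])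
  have h3 := P.norm_proj_apply_le hs (R k)
  have h4 := hT.im_inner_sub_smul hg (a + ε * Complex.I)
  rw [map_add, map_smul, add_sub_cancel_right] at h1
  rw [map_add, map_smul] at h2
  rw [add_sub_cancel_right] at h4
  have h5 : (a + ε * Complex.I : ℂ).im = ε := by simp
  rw [h4, h5, h1]
  have h6 := pow_le_pow_left₀ (norm_nonneg _) h2 2
  have h7 := pow_le_pow_left₀ (norm_nonneg _) h3 2
  have h8 : ε ^ 2 * ‖P.proj (Metric.closedBall a ε) (R k)‖ ^ 2 ≤ ε ^ 2 * ‖R k‖ ^ 2 := by gcongr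
  rw [mul_pow] at h6
  linarith

end OrthogonalSpectralMeasure.IsSpectralMeasureOf

/-- A measure whose mass on small intervals about each point of `Δ` is `o(length)` does not charge
`Δ`. -/
theorem measure_eq_zero_of_closedBall_le {μ : Measure ℝ} [IsLocallyFiniteMeasure μ] {Δ : Set ℝ}
    {g : ℝ → ℝ → ℝ}
    (hg : ∀ x ∈ Δ, Filter.Tendsto (g x) (nhdsWithin 0 (Set.Ioi 0)) (nhds 0))
    (hμ : ∀ x ∈ Δ, ∀ ε, 0 < ε → μ (Metric.closedBall x ε) ≤ ENNReal.ofReal (2 * ε * g x ε)) :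
    μ Δ = 0 := by
  have key : ∀ᵐ x ∂μ, x ∉ Δ := by
    -- Differentiate Lebesgue measure with respect to `μ`, not conversely: the derivative is finite
    -- `μ`-almost everywhere, whereas at points of `Δ` the ratios tend to `∞`.
    filter_upwards [Besicovitch.ae_tendsto_rnDeriv volume μ, Measure.rnDeriv_ne_top volume μ]
      with x hx hx' hxΔ
    refine hx' (tendsto_nhds_unique hx (ENNReal.tendsto_nhds_top fun n => ?_))
    have h1 : ∀ᶠ ε in nhdsWithin (0 : ℝ) (Set.Ioi 0), g x ε < ((n : ℝ) + 1)⁻¹ :=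
      (hg x hxΔ).eventually_lt_const (by positivity)
    filter_upwards [h1, self_mem_nhdsWithin] with ε h2 hε
    have hε : 0 < ε := hε
    have h4 : (n : ℝ≥0∞) * μ (Metric.closedBall x ε) < volume (Metric.closedBall x ε) := by
      rw [Real.volume_closedBall]
      refine (mul_le_mul_right (hμ x hxΔ ε hε) _).trans_lt ?_
      rw [← ENNReal.ofReal_natCast, ← ENNReal.ofReal_mul (by positivity),
        ENNReal.ofReal_lt_ofReal_iff (by positivity)]
      have h5 : (n : ℝ) * g x ε < 1 := by
        rcases le_or_gt (g x ε) 0 with h | h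
        · nlinarith [Nat.cast_nonneg (α := ℝ) n]
        · have := mul_lt_mul_of_pos_left h2 (show (0 : ℝ) < n + 1 by positivity)
          rw [mul_inv_cancel₀ (by positivity)] at this
          linarith
      nlinarith
    have hfin : μ (Metric.closedBall x ε) ≠ ∞ :=
      ((hμ x hxΔ ε hε).trans_lt ENNReal.ofReal_lt_top).ne
    exact (ENNReal.lt_div_iff_mul_lt (Or.inr (ENNReal.natCast_ne_top n)) (Or.inl hfin)).2 h4
  simpa [ae_iff] using key

/-! ### Compression to `H` and the two implications. -/

namespace SelfAdjointExtension

open Filter Topology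

variable {H : Type*} [NormedAddCommGroup H] [InnerProductSpace ℂ H] [CompleteSpace H]
  {A : H →ₗ.[ℂ] H}
  {K : Type*} [NormedAddCommGroup K] [InnerProductSpace ℂ K] [CompleteSpace K]
  (X : SelfAdjointExtension A K)

theorem compression_apply (S : K →L[ℂ] K) (x : H) : X.compression S x =
    ContinuousLinearMap.adjoint X.incl.toContinuousLinearMap (S (X.incl x)) :=
  rfl

theorem inner_compression (S : K →L[ℂ] K) (x y : H) :
    ⟪x, X.compression S y⟫_ℂ = ⟪X.incl x, S (X.incl y)⟫_ℂ := by
  rw [X.compression_apply, ContinuousLinearMap.adjoint_inner_right]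
  rfl

theorem compression_congr {S S' : K →L[ℂ] K} (h : ∀ x, S (X.incl x) = S' (X.incl x)) :
    X.compression S = X.compression S' := by
  ext x
  rw [X.compression_apply, X.compression_apply, h]

theorem analyticAt_compression {G : ℂ → K →L[ℂ] K} {a : ℂ} (hG : AnalyticAt ℂ G a) :
    AnalyticAt ℂ (fun z => X.compression (G z)) a := by
  let L : (K →L[ℂ] K) →L[ℂ] (H →L[ℂ] H) :=
    ContinuousLinearMap.compL ℂ H K H (ContinuousLinearMap.adjoint X.incl.toContinuousLinearMap) ∘L
      (ContinuousLinearMap.compL ℂ H K K).flip X.incl.toContinuousLinearMap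
  exact (L.analyticAt _).comp hG

theorem spectralMeasure_eq_zero_iff (P : OrthogonalSpectralMeasure K) {s : Set ℝ}
    (hs : MeasurableSet s) : X.spectralMeasure P s = 0 ↔ ∀ x, P.proj s (X.incl x) = 0 := by
  constructor
  · intro h x
    have h1 := P.inner_proj_self hs (X.incl x)
    rw [← X.inner_compression] at h1
    change (⟪x, X.spectralMeasure P s x⟫_ℂ).re = _ at h1
    rw [h] at h1
    simpa using h1.symm
  · intro h
    ext x
    change X.compression (P.proj s) x = 0
    rw [X.compression_apply, h, map_zero]

theorem admitsAnalyticContinuation_of_spectralMeasure_eq_zero {P : OrthogonalSpectralMeasure K}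
    (hP : P.IsSpectralMeasureOf X.op) {Δ : Set ℝ} (hΔ : IsOpen Δ)
    (h : X.spectralMeasure P Δ = 0) : AdmitsAnalyticContinuation X.generalizedResolvent Δ := by
  have hT := X.isSelfAdjoint_op
  rw [X.spectralMeasure_eq_zero_iff P hΔ.measurableSet] at h
  refine AdmitsAnalyticContinuation.of_local (fun z hz => ?_) fun t ht => ?_
  -- Off the real axis the Neumann series is centred at `z` itself, so the smallness condition reads
  -- `0 < 1`.
  · obtain ⟨G, hG, hGR⟩ := hP.exists_analyticAt_resolvent_mul_proj hT (a := z)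
      MeasurableSet.univ hz (by simp)
    refine (X.analyticAt_compression hG).congr ?_
    filter_upwards [hGR, Complex.continuous_im.continuousAt.eventually_ne hz] with w hw hw'
    rw [hw hw', P.proj_univ, mul_one]
    rfl
  · obtain ⟨r, hr, hrΔ⟩ := Metric.isOpen_iff.1 hΔ t ht
    have hb : MeasurableSet (Metric.ball t r) := measurableSet_ball
    have him : (t + r * Complex.I : ℂ).im ≠ 0 := by simpa using hr.ne'
    have hn : ‖(t : ℂ) - (t + r * Complex.I)‖ = r := by
      simp [abs_of_pos hr]
    obtain ⟨G, hG, hGR⟩ := hP.exists_analyticAt_resolvent_mul_proj hT (a := (t : ℂ))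
      hb.compl him (by
        have h1 := hP.norm_resolvent_mul_proj_le hT hr (hT.isResolventAt_operatorResolvent him)
        rw [hn]
        calc _ ≤ r * (4 / (5 * r)) := by gcongr
          _ = 4 / 5 := by field_simp
          _ < 1 := by norm_num)
    refine ⟨_, X.analyticAt_compression hG, ?_⟩
    filter_upwards [hGR] with z hz hz'
    rw [hz hz']
    refine X.compression_congr fun x => ?_
    change operatorResolvent X.op z (P.proj _ (X.incl x)) = _
    -- Removing the ball costs nothing on the embedded `H`, since `P(Δ)` vanishes there.
    rw [P.proj_compl_apply hb,
      P.proj_eq_zero_of_subset hb hΔ.measurableSet hrΔ (h x), sub_zero]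

/-- The boundary values of an analytic continuation of the generalized resolvent are real on the
diagonal. -/
theorem tendsto_im_inner_generalizedResolvent {F : ℂ → H →L[ℂ] H} {t : ℝ}
    (hF : ContinuousAt F t) (hFR : ∀ z : ℂ, z.im ≠ 0 → F z = X.generalizedResolvent z) (x : H) :
    Tendsto (fun ε : ℝ => (⟪x, X.generalizedResolvent (t + ε * Complex.I) x⟫_ℂ).im)
      (𝓝[>] 0) (𝓝 0) := by
  have hT := X.isSelfAdjoint_op
  let f : ℝ → ℝ := fun ε => (⟪x, F (t + ε * Complex.I) x⟫_ℂ).im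
  have hf : ContinuousAt f 0 := by
    have h1 : ContinuousAt (fun ε : ℝ => F (t + ε * Complex.I)) 0 := by
      refine ContinuousAt.comp (g := F) (by simpa using hF) ?_
      fun_prop
    have h2 : ContinuousAt (fun ε : ℝ => F (t + ε * Complex.I) x) 0 := 
      h1.clm_apply continuousAt_const
    exact Complex.continuous_im.continuousAt.comp ((innerSL ℂ x).continuous.continuousAt.comp h2)
  have hfR : ∀ ε : ℝ, ε ≠ 0 →
      f ε = (⟪x, X.generalizedResolvent (t + ε * Complex.I) x⟫_ℂ).im := fun ε hε => by
    change (⟪x, F (t + ε * Complex.I) x⟫_ℂ).im = _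
    rw [hFR _ (by simpa using hε)]
  have hsign : ∀ ε : ℝ, ε ≠ 0 → ∃ c : ℝ, 0 ≤ c ∧ f ε = ε * c := fun ε hε => by
    have him : (t + ε * Complex.I : ℂ).im ≠ 0 := by simpa using hε
    have hg := (isResolventAt_iff_graph.1 (hT.isResolventAt_operatorResolvent him)).1 (X.incl x)
    have h := hT.im_inner_sub_smul hg (t + ε * Complex.I)
    rw [add_sub_cancel_right, ← X.inner_compression] at h
    refine ⟨_, sq_nonneg _, (hfR ε hε).trans (h.trans (congrArg (· * _) ?_))⟩
    simp
  -- Since `f ε = ε c` with `c ≥ 0`, `f` is nonpositive on the left and nonnegative on the right;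
  -- continuity from both half-planes forces the value `0`.
  have h0 : f 0 = 0 := by
    refine le_antisymm ?_ ?_
    · refine le_of_tendsto (hf.tendsto.mono_left (nhdsWithin_le_nhds (s := Set.Iio 0))) ?_
      filter_upwards [self_mem_nhdsWithin] with ε hε
      obtain ⟨c, hc, h⟩ := hsign ε (ne_of_lt hε)
      rw [h]
      exact mul_nonpos_of_nonpos_of_nonneg (le_of_lt hε) hc
    · refine ge_of_tendsto (hf.tendsto.mono_left (nhdsWithin_le_nhds (s := Set.Ioi 0))) ?_
      filter_upwards [self_mem_nhdsWithin] with ε hε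
      obtain ⟨c, hc, h⟩ := hsign ε (ne_of_gt hε)
      rw [h]
      exact mul_nonneg (le_of_lt hε) hc
  have h1 : Tendsto f (𝓝[>] 0) (𝓝 0) := by
    have := hf.tendsto.mono_left (nhdsWithin_le_nhds (s := Set.Ioi 0))
    rwa [h0] at this
  refine h1.congr' ?_
  filter_upwards [self_mem_nhdsWithin] with ε hε
  exact hfR ε (ne_of_gt hε)

theorem spectralMeasure_eq_zero_of_admitsAnalyticContinuation {P : OrthogonalSpectralMeasure K}
    (hP : P.IsSpectralMeasureOf X.op) {Δ : Set ℝ} (hΔ : MeasurableSet Δ)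
    (h : AdmitsAnalyticContinuation X.generalizedResolvent Δ) : X.spectralMeasure P Δ = 0 := by
  have hT := X.isSelfAdjoint_op
  obtain ⟨F, hF, hFR⟩ := h
  rw [X.spectralMeasure_eq_zero_iff P hΔ]
  intro x
  have hμ : P.scalarMeasure (X.incl x) Δ = 0 := by
    refine measure_eq_zero_of_closedBall_le
      (g := fun t ε => (⟪x, X.generalizedResolvent (t + ε * Complex.I) x⟫_ℂ).im)
      (fun t ht => ?_) fun t _ ε hε => ?_
    · exact X.tendsto_im_inner_generalizedResolvent
        (hF _ (Or.inr ⟨t, ht, rfl⟩)).continuousAt hFR x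
    · rw [P.scalarMeasure_apply measurableSet_closedBall]
      refine ENNReal.ofReal_le_ofReal ?_
      have h1 := hP.norm_proj_closedBall_sq_le hT hε (hT.isResolventAt_operatorResolvent
        (z := t + ε * Complex.I) (by simpa using hε.ne')) (X.incl x)
      rwa [← X.inner_compression] at h1
  rw [P.scalarMeasure_apply hΔ, ENNReal.ofReal_eq_zero] at hμ
  exact norm_eq_zero.1 (pow_eq_zero_iff two_ne_zero |>.1 (le_antisymm hμ (sq_nonneg _)))

end SelfAdjointExtension

theorem proposition3p2 {H : Type*} [NormedAddCommGroup H] [InnerProductSpace ℂ H]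
    [CompleteSpace H] (A : H →ₗ.[ℂ] H) (hA_symm : A.IsFormalAdjoint A) (hA_closed : A.IsClosed)
    {K : Type*} [NormedAddCommGroup K] [InnerProductSpace ℂ K] [CompleteSpace K]
    (X : SelfAdjointExtension A K) (P : OrthogonalSpectralMeasure K)
    (hP : P.IsSpectralMeasureOf X.op) (Δ : Set ℝ) (hΔ : IsOpen Δ) :
    X.spectralMeasure P Δ = 0 ↔ AdmitsAnalyticContinuation X.generalizedResolvent Δ :=
  ⟨X.admitsAnalyticContinuation_of_spectralMeasure_eq_zero hP hΔ,
    X.spectralMeasure_eq_zero_of_admitsAnalyticContinuation hP hΔ.measurableSet⟩
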